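/- Let $p\ge 1$ and $N\in\mathbb N$. For $x\in\mathbb R^N$ put $\|x\|=(\sum_{t=1}^N|x_t|^p)^{1/p}$ and let $\mathcal P_p(\mathbb R^N)$ be the set of Borel probability measures $\mu$ on $\mathbb R^N$ with $\int\|x\|^p\,\mu(dx)<\infty$. For $\mu,\nu\in\mathcal P_p(\mathbb R^N)$ let $\Pi_{\mathrm{bc}}(\mu,\nu)$ be the set of bicausal couplings: Borel probability measures $\gamma$ on $\mathbb R^N\times\mathbb R^N$ with marginals $\mu,\nu$ such that, for all $t=1,\dots,N$ and all Borel $A\subseteq\mathbb R^t$, the conditional probability under $\gamma$ of $\{y_{1:t}\in A\}$ given $x_{1:N}$ equals almost surely the one given $x_{1:t}$, and likewise with the roles of $x$ and $y$ exchanged. The adapted Wasserstein distance $\mathcal{AW}_p$ is $$\mathcal{AW}_p(\mu,\nu)=\Big(\inf_{\gamma\in\Pi_{\mathrm{bc}}(\mu,\nu)}\int\|x-y\|^p\,\gamma(dx,dy)\Big)^{1/p}.$$ For probability measures $\gamma$ on $\mathbb R^{N-t}\times\mathbb R^{N-t}$ define $\mathcal F_{t,p}(\gamma)\in[0,\infty]$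 recursively by $\mathcal F_{N,p}=0$ and, for $t<N$, $$\mathcal F_{t,p}(\gamma)=\max\Big\{\Big(\int|x_1-y_1|^p\,\gamma^1(dx_1,dy_1)\Big)^{1/p},\ \operatorname*{ess\,sup}_{(x_1,y_1)\sim\gamma^1}\mathcal F_{t+1,p}(\bar\gamma_{x_1,y_1})\Big\},$$ where $\gamma^1$ is the law of $(x_1,y_1)$ under $\gamma$ and $\bar\gamma_{x_1,y_1}$ is the regular conditional law of the remaining coordinates given $(x_1,y_1)$. The adapted $(p,\infty)$-Wasserstein distance is $$\mathcal{AW}_p^\infty(\mu,\nu)=\inf_{\gamma\in\Pi_{\mathrm{bc}}(\mu,\nu)}\mathcal F_{0,p}(\gamma)\in[0,\infty].$$ Then $\mathcal{AW}_p^\infty$ is an extended metric on $\mathcal P_p(\mathbb R^N)$ (a metric which may take the value $+\infty$): for all $\mu,\nu,\eta\in\mathcal P_p(\mathbb R^N)$, $\mathcal{AW}_p^\infty(\mu,\nu)=0$ if and only if $\mu=\nu$, $\mathcal{AW}_p^\infty(\mu,\nu)=\mathcal{AW}_p^\infty(\nu,\mu)$, and $\mathcal{AW}_p^\infty(\mu,\nu)\le\mathcal{AW}_p^\infty(\mu,\eta)+\mathcal{AW}_p^\infty(\eta,\nu)$.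 Moreover $\mathcal{AW}_p(\mu,\nu)\le N^{1/p}\,\mathcal{AW}_p^\infty(\mu,\nu)$ for all $\mu,\nu\in\mathcal P_p(\mathbb R^N)$. -/

import Mathlib

open MeasureTheory ProbabilityTheory
open scoped ENNReal

noncomputable section

namespace AdaptedWasserstein

/-- The space of paths `x = (x_1, …, x_N)`, i.e. `ℝ^N` with its Borel σ-algebra. -/
abbrev Path (N : ℕ) : Type := Fin N → ℝ

/-- The norm `‖x‖ = (∑ |x_t|^p)^(1/p)` on `ℝ^N`. -/
def pNorm (p : ℝ) {N : ℕ} (x : Path N) : ℝ := (∑ t, |x t| ^ p) ^ (1 / p)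

/-- `𝒫_p(ℝ^N)`: Borel probability measures on `ℝ^N` with `∫ ‖x‖^p μ(dx) < ∞`. -/
abbrev PpSpace (p : ℝ) (N : ℕ) : Type :=
  {μ : ProbabilityMeasure (Path N) //
    ∫⁻ x, ENNReal.ofReal (pNorm p x ^ p) ∂(μ : Measure (Path N)) < ∞}

/-- The initial segment `x_{1:t}` of a path. -/
def initSeg {N t : ℕ} (h : t ≤ N) (x : Path N) : Path t := fun i => x (Fin.castLE h i)

/-- The set `Π(μ, ν)` of transport plans between `μ` and `ν`. -/
def couplings {N : ℕ} (μ ν : ProbabilityMeasure (Path N)) :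
    Set (ProbabilityMeasure (Path N × Path N)) :=
  {γ | (γ : Measure (Path N × Path N)).map Prod.fst = μ ∧
    (γ : Measure (Path N × Path N)).map Prod.snd = ν}

/-- Causality of `γ`, the law of `(X, Y)`: for all `t = 1, …, N` and Borel sets `A ⊆ ℝ^t`,
`γ_{x_{1:N}}(y_{1:t} ∈ A) = γ_{x_{1:t}}(y_{1:t} ∈ A)` for almost every `x`, where the two sides are
regular conditional distributions of `Y_{1:t}` given `X` and given `X_{1:t}`. -/
def IsCausal {N : ℕ} (γ : ProbabilityMeasure (Path N × Path N)) : Prop :=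
  ∀ (t : ℕ) (_ : 1 ≤ t) (h : t ≤ N) (A : Set (Path t)), MeasurableSet A →
    ∀ᵐ x ∂((γ : Measure (Path N × Path N)).map Prod.fst),
      condDistrib (fun w : Path N × Path N => initSeg h w.2) (fun w => w.1)
          (γ : Measure (Path N × Path N)) x A =
        condDistrib (fun w : Path N × Path N => initSeg h w.2) (fun w => initSeg h w.1)
          (γ : Measure (Path N × Path N)) (initSeg h x) A

/-- `γ` with the roles of `x` and `y` exchanged. -/
def swapPlan {N : ℕ} (γ : ProbabilityMeasure (Path N × Path N)) :
    ProbabilityMeasure (Path N × Path N) :=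
  γ.map measurable_swap.aemeasurable

/-- The set `Π_bc(μ, ν)` of bicausal transport plans. -/
def bicausalCouplings {N : ℕ} (μ ν : ProbabilityMeasure (Path N)) :
    Set (ProbabilityMeasure (Path N × Path N)) :=
  {γ | γ ∈ couplings μ ν ∧ IsCausal γ ∧ IsCausal (swapPlan γ)}

/-- The adapted Wasserstein distance
`𝒜𝒲_p(μ, ν) = (inf_{γ ∈ Π_bc(μ, ν)} ∫ ‖x - y‖^p γ(dx, dy))^(1/p)`. -/
def AW (p : ℝ) {N : ℕ} (μ ν : PpSpace p N) : ℝ≥0∞ :=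
  (⨅ γ ∈ bicausalCouplings μ.1 ν.1,
    ∫⁻ w, ENNReal.ofReal (pNorm p (w.1 - w.2) ^ p) ∂(γ : Measure (Path N × Path N))) ^ (1 / p)

/-- `𝒞_p(π) = (∫ |x_1 - y_1|^p π(dx_1, dy_1))^(1/p)` for `π` on `ℝ × ℝ`. -/
def stepCost (p : ℝ) (π : Measure (ℝ × ℝ)) : ℝ≥0∞ :=
  (∫⁻ z, ENNReal.ofReal (|z.1 - z.2| ^ p) ∂π) ^ (1 / p)

/-- The rearrangement `(x, y) ↦ ((x_1, y_1), (x_{2:n+1}, y_{2:n+1}))`. -/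
def splitFirst {n : ℕ} (w : Path (n + 1) × Path (n + 1)) : (ℝ × ℝ) × (Path n × Path n) :=
  ((w.1 0, w.2 0), (fun i => w.1 i.succ, fun i => w.2 i.succ))

theorem measurable_splitFirst {n : ℕ} : Measurable (splitFirst (n := n)) := by
  unfold splitFirst
  fun_prop

/-- The first-step law `γ^1`, i.e. the law of `(x_1, y_1)` under `γ`. -/
def firstLaw {n : ℕ} (γ : ProbabilityMeasure (Path (n + 1) × Path (n + 1))) : Measure (ℝ × ℝ) :=
  ((γ : Measure (Path (n + 1) × Path (n + 1))).map splitFirst).fst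

/-- The disintegration `γ̄_{x_1, y_1}`: the regular conditional distribution under `γ` of the
remaining coordinates `(x_{2:n+1}, y_{2:n+1})` given `(x_1, y_1) = z`. -/
def restLaw {n : ℕ} (γ : ProbabilityMeasure (Path (n + 1) × Path (n + 1))) (z : ℝ × ℝ) :
    ProbabilityMeasure (Path n × Path n) :=
  ⟨((γ : Measure (Path (n + 1) × Path (n + 1))).map splitFirst).condKernel z, inferInstance⟩

/-- The functional `𝓕_{t,p}` on laws of pairs of paths with `n = N - t` remaining steps:
`𝓕 = 0` if no step remains, and otherwise
`𝓕(γ) = 𝒞_p(γ^1) ∨ ‖𝓕(γ̄_{x_1, y_1})‖_{L^∞(γ^1)}`. -/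
def adaptedCost (p : ℝ) : (n : ℕ) → ProbabilityMeasure (Path n × Path n) → ℝ≥0∞
  | 0, _ => 0
  | n + 1, γ =>
      max (stepCost p (firstLaw γ))
        (essSup (fun z => adaptedCost p n (restLaw γ z)) (firstLaw γ))

/-- The adapted `(p, ∞)`-Wasserstein distance `inf_{γ ∈ Π_bc(μ, ν)} 𝓕_{0,p}(γ)`, as an element of
`[0, ∞]`. -/
def AWinf (p : ℝ) {N : ℕ} (μ ν : PpSpace p N) : ℝ≥0∞ :=
  ⨅ γ ∈ bicausalCouplings μ.1 ν.1, adaptedCost p N γ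

end AdaptedWasserstein

end

noncomputable section

namespace AdaptedWasserstein

/-! ### Comparison of measures on a countable family of open sets -/

/-! For finite `C`, the recursive condition `adaptedCost p n γ ≤ C` unfolds into a family of
one-step conditions, `CondBound p C γ`: given `(x_{1:t}, y_{1:t})`, the conditional mean of
`|x_{t+1} - y_{t+1}|^p` is at most `C ^ p`, for each `t`. `condBound_of_adaptedCost_le` and
`adaptedCost_le_of_condBound` give this equivalence; the nested essential suprema then disappear
from the argument.

Symmetry holds since `CondBound` is invariant under swapping the paths, and the diagonal plan
satisfies it with `C = 0`. Taking expectations and summing over the `N` steps bounds `AW`. If `AW`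
vanishes, Markov's inequality compares the two measures on closed sets, in both directions after
symmetry, so they agree.

For the triangle inequality, two plans are glued along their common marginal `Y`, with `X` and `Z`
conditionally independent given `Y`. Causality makes `Z_{1:t}` independent of `(X, Y)` given
`Y_{1:t}`, so the bound for `(Y, X)` survives conditioning on `(X_{1:t}, Z_{1:t})`; likewise for
`(Y, Z)`. Minkowski's inequality on each event of the past adds the two constants
(`condBound_gluedPlan`). Only this step needs `1 ≤ p`. -/

/-- An inequality does not extend from a π-system as an equality does. Finite unions of basic open
sets form a directed family exhausting any open set, and outer regularity of `m₂` then reaches all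
sets. -/
theorem measure_le_of_forall_finset_countableBasis {E : Type*} [TopologicalSpace E]
    [SecondCountableTopology E] [MeasurableSpace E] {m₁ m₂ : Measure E} [m₂.OuterRegular]
    (h : ∀ F : Finset (TopologicalSpace.countableBasis E),
      m₁ (⋃ b ∈ F, (b : Set E)) ≤ m₂ (⋃ b ∈ F, (b : Set E))) : m₁ ≤ m₂ := by
  have hopen : ∀ U : Set E, IsOpen U → m₁ U ≤ m₂ U := by
    intro U hU
    let I := {b : TopologicalSpace.countableBasis E // (b : Set E) ⊆ U}
    have hUeq : U = ⋃ F : Finset I, ⋃ b ∈ F, ((b : TopologicalSpace.countableBasis E) : Set E) := by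
      apply Set.Subset.antisymm
      · intro x hx
        obtain ⟨b, hb, hxb, hbU⟩ :=
          (TopologicalSpace.isBasis_countableBasis E).exists_subset_of_mem_open hx hU
        simp only [Set.mem_iUnion]
        exact ⟨{⟨⟨b, hb⟩, hbU⟩}, ⟨⟨b, hb⟩, hbU⟩, Finset.mem_singleton_self _, hxb⟩
      · simp only [Set.iUnion_subset_iff]
        exact fun F b _ => b.2
    have hdir : Directed (· ⊆ ·) fun F : Finset I =>
        ⋃ b ∈ F, ((b : TopologicalSpace.countableBasis E) : Set E) :=
      Monotone.directed_le fun F G hFG => Set.biUnion_subset_biUnion_left hFG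
    have : Countable (TopologicalSpace.countableBasis E) :=
      (TopologicalSpace.countable_countableBasis E).to_subtype
    rw [hUeq, hdir.measure_iUnion]
    refine iSup_le fun F => ?_
    have hF := h (F.map (Function.Embedding.subtype _))
    have hF' : (⋃ b ∈ F.map (Function.Embedding.subtype _), (b : Set E)) =
        ⋃ b ∈ F, ((b : TopologicalSpace.countableBasis E) : Set E) := by
      ext x
      simp only [Set.mem_iUnion, Finset.mem_map, Function.Embedding.subtype_apply, exists_prop]
      constructor
      · rintro ⟨_, ⟨i, hi, rfl⟩, hx⟩
        exact ⟨i, hi, hx⟩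
      · rintro ⟨i, hi, hx⟩
        exact ⟨_, ⟨i, hi, rfl⟩, hx⟩
    rw [hF'] at hF
    exact hF.trans (measure_mono (Set.subset_iUnion (fun F : Finset I =>
        ⋃ b ∈ F, ((b : TopologicalSpace.countableBasis E) : Set E)) F))
  refine Measure.le_iff.2 fun s _ => le_of_forall_gt fun r hr => ?_
  obtain ⟨U, hsU, hU, hUr⟩ := s.exists_isOpen_lt_of_lt r hr
  exact ((measure_mono hsU).trans (hopen U hU)).trans_lt hUr

/-- There are only countably many finite unions of basic open sets, so their exceptional null sets
merge into one. -/
theorem ae_measure_le_of_forall_setLIntegral_le {Z E : Type*} [MeasurableSpace Z]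
    [TopologicalSpace E] [SecondCountableTopology E] [MeasurableSpace E] [BorelSpace E]
    {m : Measure Z} [SigmaFinite m] {κ₁ κ₂ : Z → Measure E} (hκ : Measurable κ₁)
    [∀ z, (κ₂ z).OuterRegular]
    (h : ∀ S : Set Z, MeasurableSet S → ∀ U : Set E, MeasurableSet U →
      ∫⁻ z in S, κ₁ z U ∂m ≤ ∫⁻ z in S, κ₂ z U ∂m) : ∀ᵐ z ∂m, κ₁ z ≤ κ₂ z := by
  have : Countable (TopologicalSpace.countableBasis E) :=
    (TopologicalSpace.countable_countableBasis E).to_subtype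
  have hm : ∀ F : Finset (TopologicalSpace.countableBasis E),
      MeasurableSet (⋃ b ∈ F, (b : Set E)) := fun F => (isOpen_biUnion fun b _ =>
        TopologicalSpace.isOpen_of_mem_countableBasis b.2).measurableSet
  have key : ∀ᵐ z ∂m, ∀ F : Finset (TopologicalSpace.countableBasis E),
      κ₁ z (⋃ b ∈ F, (b : Set E)) ≤ κ₂ z (⋃ b ∈ F, (b : Set E)) :=
    ae_all_iff.2 fun F => ae_le_of_forall_setLIntegral_le_of_sigmaFinite
      (Measure.measurable_measure.1 hκ _ (hm F)) fun S hS _ => h S hS _ (hm F)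
  filter_upwards [key] with z hz
  exact measure_le_of_forall_finset_countableBasis hz

/-! ### The stepwise description of the adapted cost -/

/-- The `p`-th power of the distance between the two paths at time `t`. -/
def gap (p : ℝ) {n : ℕ} (t : Fin n) (w : Path n × Path n) : ℝ≥0∞ :=
  ENNReal.ofReal (|w.1 t - w.2 t| ^ p)

theorem measurable_gap (p : ℝ) {n : ℕ} (t : Fin n) : Measurable (gap p t) := by
  unfold gap
  fun_prop

theorem measurable_initSeg {N t : ℕ} (h : t ≤ N) : Measurable (initSeg h) := by
  unfold initSeg
  fun_prop

/-- The pair of initial segments `(x_{1:t}, y_{1:t})`. -/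
def initPair {n t : ℕ} (h : t ≤ n) (w : Path n × Path n) : Path t × Path t :=
  (initSeg h w.1, initSeg h w.2)

theorem measurable_initPair {n t : ℕ} (h : t ≤ n) : Measurable (initPair h) :=
  ((measurable_initSeg h).comp measurable_fst).prodMk ((measurable_initSeg h).comp measurable_snd)

/-- For every `t`, `E[|x_{t+1} - y_{t+1}|^p | x_{1:t}, y_{1:t}] ≤ C^p` almost surely. -/
def CondBound (p : ℝ) {n : ℕ} (C : ℝ≥0∞) (γ : Measure (Path n × Path n)) : Prop :=
  ∀ (t : ℕ) (ht : t < n),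
    (γ.withDensity (gap p ⟨t, ht⟩)).map (initPair ht.le) ≤ C ^ p • γ.map (initPair ht.le)

theorem map_withDensity_gap_apply (p : ℝ) {n t : ℕ} (ht : t < n) (γ : Measure (Path n × Path n))
    {B : Set (Path t × Path t)} (hB : MeasurableSet B) :
    (γ.withDensity (gap p ⟨t, ht⟩)).map (initPair ht.le) B =
      ∫⁻ w, (initPair ht.le ⁻¹' B).indicator (gap p ⟨t, ht⟩) w ∂γ := by
  rw [Measure.map_apply (measurable_initPair _) hB,
    withDensity_apply _ (measurable_initPair _ hB),
    lintegral_indicator (measurable_initPair _ hB)]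

theorem condBound_iff {p : ℝ} {n : ℕ} {C : ℝ≥0∞} {γ : Measure (Path n × Path n)} :
    CondBound p C γ ↔ ∀ (t : ℕ) (ht : t < n) (B : Set (Path t × Path t)), MeasurableSet B →
      ∫⁻ w, (initPair ht.le ⁻¹' B).indicator (gap p ⟨t, ht⟩) w ∂γ ≤
        C ^ p * γ (initPair ht.le ⁻¹' B) := by
  refine forall₂_congr fun t ht => Measure.le_iff.trans (forall₂_congr fun B hB => ?_)
  rw [map_withDensity_gap_apply p ht γ hB, Measure.smul_apply, smul_eq_mul,
    Measure.map_apply (measurable_initPair _) hB]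

theorem CondBound.lintegral_le {p : ℝ} {n : ℕ} {C : ℝ≥0∞} {γ : Measure (Path n × Path n)}
    (h : CondBound p C γ) {t : ℕ} (ht : t < n) {f : Path t × Path t → ℝ≥0∞} (hf : Measurable f) :
    ∫⁻ w, gap p ⟨t, ht⟩ w * f (initPair ht.le w) ∂γ ≤ C ^ p * ∫⁻ w, f (initPair ht.le w) ∂γ := by
  have := lintegral_mono' (h t ht) (le_refl f)
  rwa [lintegral_map hf (measurable_initPair _),
    lintegral_withDensity_eq_lintegral_mul (g := fun w => f (initPair ht.le w)) _
      (measurable_gap _ _) (hf.comp (measurable_initPair _)), lintegral_smul_measure, smul_eq_mul,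
    lintegral_map hf (measurable_initPair _)] at this

theorem lintegral_splitFirst {n : ℕ} (γ : ProbabilityMeasure (Path (n + 1) × Path (n + 1)))
    {f : (ℝ × ℝ) × (Path n × Path n) → ℝ≥0∞} (hf : Measurable f) :
    ∫⁻ w, f (splitFirst w) ∂(γ : Measure (Path (n + 1) × Path (n + 1))) =
      ∫⁻ z, ∫⁻ r, f (z, r) ∂(restLaw γ z : Measure (Path n × Path n)) ∂(firstLaw γ) := by
  have := Measure.isProbabilityMeasure_map (μ := (γ : Measure (Path (n + 1) × Path (n + 1))))
    measurable_splitFirst.aemeasurable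
  rw [← lintegral_map hf measurable_splitFirst, ← Measure.lintegral_condKernel hf]
  rfl

/-- The inverse of `splitFirst` -/
def joinFirst {n : ℕ} (v : (ℝ × ℝ) × (Path n × Path n)) : Path (n + 1) × Path (n + 1) :=
  (Fin.cons v.1.1 v.2.1, Fin.cons v.1.2 v.2.2)

theorem measurable_joinFirst {n : ℕ} : Measurable (joinFirst (n := n)) := by
  refine Measurable.prodMk (measurable_pi_lambda _ fun i => ?_)
    (measurable_pi_lambda _ fun i => ?_)
  all_goals
    refine Fin.cases ?_ (fun j => ?_) i
    · simp only [Fin.cons_zero]; fun_prop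
    · simp only [Fin.cons_succ]; fun_prop

theorem joinFirst_splitFirst {n : ℕ} (w : Path (n + 1) × Path (n + 1)) :
    joinFirst (splitFirst w) = w := by
  refine Prod.ext (funext fun i => ?_) (funext fun i => ?_) <;>
    exact Fin.cases rfl (fun j => rfl) i

theorem lintegral_eq_lintegral_restLaw {n : ℕ}
    (γ : ProbabilityMeasure (Path (n + 1) × Path (n + 1)))
    {f : Path (n + 1) × Path (n + 1) → ℝ≥0∞} (hf : Measurable f) :
    ∫⁻ w, f w ∂(γ : Measure (Path (n + 1) × Path (n + 1))) =
      ∫⁻ z, ∫⁻ r, f (joinFirst (z, r)) ∂(restLaw γ z : Measure (Path n × Path n))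
        ∂(firstLaw γ) := by
  rw [← lintegral_splitFirst γ (f := fun v => f (joinFirst v)) (hf.comp measurable_joinFirst)]
  simp [joinFirst_splitFirst]

theorem initPair_succ_joinFirst {n t : ℕ} (h : t + 1 ≤ n + 1) (v : (ℝ × ℝ) × (Path n × Path n)) :
    initPair h (joinFirst v) = joinFirst (v.1, initPair (Nat.le_of_succ_le_succ h) v.2) := by
  refine Prod.ext (funext fun i => ?_) (funext fun i => ?_) <;>
    exact Fin.cases rfl (fun j => rfl) i

theorem isProbabilityMeasure_firstLaw {n : ℕ}
    (γ : ProbabilityMeasure (Path (n + 1) × Path (n + 1))) : IsProbabilityMeasure (firstLaw γ) := by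
  have := Measure.isProbabilityMeasure_map (μ := (γ : Measure (Path (n + 1) × Path (n + 1))))
    measurable_splitFirst.aemeasurable
  unfold firstLaw
  infer_instance

theorem stepCost_le_iff {p : ℝ} (hp : 0 < p) {n : ℕ} {C : ℝ≥0∞}
    (γ : ProbabilityMeasure (Path (n + 1) × Path (n + 1))) :
    stepCost p (firstLaw γ) ≤ C ↔
      ∫⁻ w, gap p 0 w ∂(γ : Measure (Path (n + 1) × Path (n + 1))) ≤ C ^ p := by
  have hf : Measurable fun z : ℝ × ℝ => ENNReal.ofReal (|z.1 - z.2| ^ p) := by fun_prop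
  have h1 : ∫⁻ z, ENNReal.ofReal (|z.1 - z.2| ^ p) ∂(firstLaw γ) =
      ∫⁻ w, gap p 0 w ∂(γ : Measure (Path (n + 1) × Path (n + 1))) := by
    rw [firstLaw, Measure.fst, lintegral_map hf measurable_fst,
      lintegral_map (f := fun z => ENNReal.ofReal (|z.1.1 - z.1.2| ^ p)) (by fun_prop)
        measurable_splitFirst]
    rfl
  rw [stepCost, h1, one_div, ENNReal.rpow_inv_le_iff hp]

/-- Fixing the first step turns an event of the first `t + 1` steps into an event of the first `t`
remaining steps; this drives the induction on the horizon. -/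
theorem indicator_joinFirst {n t : ℕ} (ht : t + 1 < n + 1) (B : Set (Path (t + 1) × Path (t + 1)))
    {f : Path (n + 1) × Path (n + 1) → ℝ≥0∞} {g : Path n × Path n → ℝ≥0∞} {z : ℝ × ℝ}
    {r : Path n × Path n} (hfg : f (joinFirst (z, r)) = g r) :
    (initPair ht.le ⁻¹' B).indicator f (joinFirst (z, r)) =
      (initPair (Nat.lt_of_succ_lt_succ ht).le ⁻¹' ((fun s => joinFirst (z, s)) ⁻¹' B)).indicator
        g r := by
  have : (joinFirst (z, r) ∈ initPair ht.le ⁻¹' B) ↔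
      r ∈ initPair (Nat.lt_of_succ_lt_succ ht).le ⁻¹' ((fun s => joinFirst (z, s)) ⁻¹' B) := by
    rw [Set.mem_preimage, initPair_succ_joinFirst]; rfl
  by_cases h : joinFirst (z, r) ∈ initPair ht.le ⁻¹' B
  · rw [Set.indicator_of_mem h, Set.indicator_of_mem (this.1 h), hfg]
  · rw [Set.indicator_of_notMem h, Set.indicator_of_notMem (mt this.2 h)]

theorem gap_indicator_joinFirst (p : ℝ) {n t : ℕ} (ht : t + 1 < n + 1)
    (B : Set (Path (t + 1) × Path (t + 1))) (z : ℝ × ℝ) (r : Path n × Path n) :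
    (initPair ht.le ⁻¹' B).indicator (gap p ⟨t + 1, ht⟩) (joinFirst (z, r)) =
      (initPair (Nat.lt_of_succ_lt_succ ht).le ⁻¹' ((fun s => joinFirst (z, s)) ⁻¹' B)).indicator
        (gap p ⟨t, Nat.lt_of_succ_lt_succ ht⟩) r :=
  indicator_joinFirst ht B rfl

theorem one_indicator_joinFirst {n t : ℕ} (ht : t + 1 < n + 1)
    (B : Set (Path (t + 1) × Path (t + 1))) (z : ℝ × ℝ) (r : Path n × Path n) :
    (initPair ht.le ⁻¹' B).indicator (1 : Path (n + 1) × Path (n + 1) → ℝ≥0∞) (joinFirst (z, r)) =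
      (initPair (Nat.lt_of_succ_lt_succ ht).le ⁻¹' ((fun s => joinFirst (z, s)) ⁻¹' B)).indicator
        (1 : Path n × Path n → ℝ≥0∞) r :=
  indicator_joinFirst ht B rfl

/-- By induction on `n`: almost every `restLaw` satisfies the bound on the slices of `B`, and
integrating over the first step gives it for `B`. -/
theorem condBound_of_adaptedCost_le {p : ℝ} (hp : 0 < p) {C : ℝ≥0∞} (hC : C ≠ ∞) : ∀ {n : ℕ}
    (γ : ProbabilityMeasure (Path n × Path n)), adaptedCost p n γ ≤ C →
      CondBound p C (γ : Measure (Path n × Path n))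
  | 0, _, _ => fun t ht => absurd ht (Nat.not_lt_zero t)
  | n + 1, γ, h => by
    obtain ⟨h0, h1⟩ := max_le_iff.1 h
    rw [stepCost_le_iff hp] at h0
    have hrest : ∀ᵐ z ∂(firstLaw γ), CondBound p C (restLaw γ z : Measure (Path n × Path n)) := by
      filter_upwards [ENNReal.ae_le_essSup fun z => adaptedCost p n (restLaw γ z)] with z hz
      exact condBound_of_adaptedCost_le hp hC _ (hz.trans h1)
    refine condBound_iff.2 fun t ht B hB => ?_
    cases t with
    | zero =>
      -- At time zero the past is a single point, so the bound is the unconditional one on the first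
      -- step.
      rcases Set.eq_empty_or_nonempty B with rfl | hne
      · simp
      · rw [Subsingleton.eq_univ_of_nonempty hne]
        simpa using h0
    | succ t =>
      have hmB := measurable_initPair ht.le hB
      rw [lintegral_eq_lintegral_restLaw γ ((measurable_gap p _).indicator hmB),
        ← lintegral_indicator_one hmB,
        lintegral_eq_lintegral_restLaw γ (measurable_one.indicator hmB)]
      rw [← lintegral_const_mul' _ _ (ENNReal.rpow_ne_top_of_nonneg hp.le hC)]
      refine lintegral_mono_ae ?_
      filter_upwards [hrest] with z hz
      have hBz : MeasurableSet ((fun s => joinFirst (z, s)) ⁻¹' B) :=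
        (measurable_joinFirst.comp measurable_prodMk_left) hB
      refine le_trans (le_of_eq ?_) ((condBound_iff.1 hz t (Nat.lt_of_succ_lt_succ ht) _ hBz).trans
        (le_of_eq ?_))
      · exact lintegral_congr fun r => gap_indicator_joinFirst p ht B z r
      · rw [← lintegral_indicator_one (measurable_initPair _ hBz)]
        congr 1
        exact lintegral_congr fun r => (one_indicator_joinFirst ht B z r).symm

/-- The bound must pass to almost every `restLaw` with a null set not depending on the test event,
whence the comparison of measures above. Measurability of `adaptedCost` in `z` is never needed. -/
theorem adaptedCost_le_of_condBound {p : ℝ} (hp : 0 < p) {C : ℝ≥0∞} (hC : C ≠ ∞) : ∀ {n : ℕ}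
    (γ : ProbabilityMeasure (Path n × Path n)), CondBound p C (γ : Measure (Path n × Path n)) →
      adaptedCost p n γ ≤ C
  | 0, _, _ => zero_le
  | n + 1, γ, h => by
    have := isProbabilityMeasure_firstLaw γ
    refine max_le ((stepCost_le_iff hp γ).2 ?_) ?_
    · simpa using condBound_iff.1 h 0 n.succ_pos Set.univ MeasurableSet.univ
    refine essSup_le_of_ae_le _ ?_
    have key : ∀ᵐ z ∂(firstLaw γ), CondBound p C (restLaw γ z : Measure (Path n × Path n)) := by
      refine ae_all_iff.2 fun t => ?_
      by_cases ht : t < n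
      swap
      · exact Filter.Eventually.of_forall fun z ht' => absurd ht' ht
      have hker : Measurable fun z => (restLaw γ z : Measure (Path n × Path n)) :=
        (((γ : Measure (Path (n + 1) × Path (n + 1))).map splitFirst).condKernel).measurable
      have hmeas : Measurable fun z =>
          ((restLaw γ z : Measure (Path n × Path n)).withDensity (gap p ⟨t, ht⟩)).map
            (initPair ht.le) := by
        refine Measure.measurable_of_measurable_coe _ fun B hB => ?_
        simp only [map_withDensity_gap_apply p ht _ hB]
        exact (Measure.measurable_lintegral
          ((measurable_gap p _).indicator (measurable_initPair _ hB))).comp hker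
      have hreg : ∀ z, (C ^ p • (restLaw γ z : Measure (Path n × Path n)).map
          (initPair ht.le)).OuterRegular := fun z =>
        Measure.OuterRegular.smul _ (ENNReal.rpow_ne_top_of_nonneg hp.le hC)
      refine (ae_measure_le_of_forall_setLIntegral_le hmeas (κ₂ := fun z =>
        C ^ p • (restLaw γ z : Measure (Path n × Path n)).map (initPair ht.le))
        fun S hS U hU => ?_).mono fun z hz _ => hz
      -- Testing `h` at time `t + 1` on a rectangle, with `S` for the first step and `U` for the
      -- next `t`, gives the integrated inequality over `S`.
      have hB : MeasurableSet (splitFirst ⁻¹' (S ×ˢ U) : Set (Path (t + 1) × Path (t + 1))) :=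
        measurable_splitFirst (hS.prod hU)
      have hmB := measurable_initPair (Nat.succ_lt_succ ht).le hB
      have hineq := condBound_iff.1 h (t + 1) (Nat.succ_lt_succ ht) _ hB
      have hpre : ∀ z, (fun s => joinFirst (z, s)) ⁻¹' (splitFirst ⁻¹' (S ×ˢ U) :
          Set (Path (t + 1) × Path (t + 1))) = {s | z ∈ S ∧ s ∈ U} := fun z => rfl
      rw [lintegral_eq_lintegral_restLaw γ ((measurable_gap p _).indicator hmB),
        ← lintegral_indicator_one hmB,
        lintegral_eq_lintegral_restLaw γ (measurable_one.indicator hmB)] at hineq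
      rw [← lintegral_indicator hS, ← lintegral_indicator hS]
      refine le_trans (le_of_eq (lintegral_congr fun z => ?_)) (hineq.trans (le_of_eq ?_))
      · simp only [gap_indicator_joinFirst, hpre]
        by_cases hz : z ∈ S
        · simp [hz, map_withDensity_gap_apply p ht _ hU]
        · simp [hz]
      · rw [← lintegral_const_mul' _ _ (ENNReal.rpow_ne_top_of_nonneg hp.le hC)]
        refine lintegral_congr fun z => ?_
        rw [lintegral_congr fun r => one_indicator_joinFirst (Nat.succ_lt_succ ht) _ z r, hpre]
        by_cases hz : z ∈ S
        · simp only [Set.indicator_of_mem hz, Measure.smul_apply, smul_eq_mul, hz, true_and,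
            Measure.map_apply (measurable_initPair _) hU,
            ← lintegral_indicator_one (measurable_initPair ht.le hU)]
          rfl
        · simp [hz]
    filter_upwards [key] with z hz
    exact adaptedCost_le_of_condBound hp hC _ hz

/-! ### Causality in terms of kernels -/

/-- For every `t`, the conditional law of `y_{1:t}` given `x` is a kernel applied to `x_{1:t}`. -/
def HasCausalKernels {N : ℕ} (γ : Measure (Path N × Path N)) : Prop :=
  ∀ (t : ℕ) (h : t ≤ N), ∃ k : Kernel (Path t) (Path t), IsMarkovKernel k ∧
    γ.map (fun w => (w.1, initSeg h w.2)) =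
      (γ.map Prod.fst) ⊗ₘ (k.comap (initSeg h) (measurable_initSeg h))

/-- In `IsCausal` the null set may depend on `A`; this is harmless because joint laws are compared
on rectangles. -/
theorem hasCausalKernels_of_isCausal {N : ℕ} {γ : ProbabilityMeasure (Path N × Path N)}
    (hγ : IsCausal γ) : HasCausalKernels (γ : Measure (Path N × Path N)) := by
  intro t h
  have hm : Measurable fun w : Path N × Path N => initSeg h w.2 :=
    (measurable_initSeg h).comp measurable_snd
  have := Measure.isProbabilityMeasure_map (μ := (γ : Measure (Path N × Path N)))
    measurable_fst.aemeasurable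
  refine ⟨condDistrib (fun w : Path N × Path N => initSeg h w.2) (fun w => initSeg h w.1)
    (γ : Measure (Path N × Path N)), inferInstance, ?_⟩
  rw [← compProd_map_condDistrib (X := fun w : Path N × Path N => w.1) hm.aemeasurable]
  refine Measure.ext_prod fun {s A} hs hA => ?_
  rw [Measure.compProd_apply_prod hs hA, Measure.compProd_apply_prod hs hA]
  refine setLIntegral_congr_fun_ae hs ?_
  have hae : ∀ᵐ x ∂((γ : Measure (Path N × Path N)).map Prod.fst),
      condDistrib (fun w : Path N × Path N => initSeg h w.2) (fun w => w.1)
          (γ : Measure (Path N × Path N)) x A =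
        condDistrib (fun w : Path N × Path N => initSeg h w.2) (fun w => initSeg h w.1)
          (γ : Measure (Path N × Path N)) (initSeg h x) A := by
    -- `IsCausal` starts at `t = 1`; at `t = 0` the target is a point and both kernels are Markov.
    rcases Nat.eq_zero_or_pos t with rfl | ht
    · rcases Set.eq_empty_or_nonempty A with rfl | hne
      · simp
      · simp [Subsingleton.eq_univ_of_nonempty hne]
    · exact hγ t ht h A hA
  filter_upwards [hae] with x hx _
  rw [hx, Kernel.comap_apply]

/-- The kernel `k` also disintegrates the law of the two initial segments, so by uniqueness both
conditional distributions are given by `k`. -/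
theorem isCausal_of_hasCausalKernels {N : ℕ} {γ : ProbabilityMeasure (Path N × Path N)}
    (hγ : HasCausalKernels (γ : Measure (Path N × Path N))) : IsCausal γ := by
  intro t _ h A hA
  obtain ⟨k, hk, heq⟩ := hγ t h
  have hm : Measurable fun w : Path N × Path N => initSeg h w.2 :=
    (measurable_initSeg h).comp measurable_snd
  have h1 := condDistrib_ae_eq_of_measure_eq_compProd (fun w : Path N × Path N => w.1)
    hm.aemeasurable heq
  have hI := measurable_initSeg h
  have h2 : (γ : Measure (Path N × Path N)).map (fun w => (initSeg h w.1, initSeg h w.2)) =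
      (γ : Measure (Path N × Path N)).map (fun w => initSeg h w.1) ⊗ₘ k := by
    have e1 : (γ : Measure (Path N × Path N)).map (fun w => (initSeg h w.1, initSeg h w.2)) =
        ((γ : Measure (Path N × Path N)).map (fun w => (w.1, initSeg h w.2))).map
          (fun v => (initSeg h v.1, v.2)) := by
      rw [Measure.map_map (by fun_prop) (by fun_prop)]
      rfl
    have e2 : (γ : Measure (Path N × Path N)).map (fun w => initSeg h w.1) =
        ((γ : Measure (Path N × Path N)).map Prod.fst).map (initSeg h) := by
      rw [Measure.map_map hI measurable_fst]
      rfl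
    rw [e1, e2, heq]
    have := Measure.isProbabilityMeasure_map (μ := (γ : Measure (Path N × Path N)))
      measurable_fst.aemeasurable
    have := Measure.isProbabilityMeasure_map
      (μ := (γ : Measure (Path N × Path N)).map Prod.fst) hI.aemeasurable
    refine Measure.ext_of_lintegral _ fun f hf => ?_
    rw [lintegral_map hf (by fun_prop), Measure.lintegral_compProd (by fun_prop),
      Measure.lintegral_compProd hf, lintegral_map _ hI]
    · simp only [Kernel.lintegral_comap]
    · exact hf.lintegral_kernel_prod_right'
  have h3 := condDistrib_ae_eq_of_measure_eq_compProd (fun w : Path N × Path N => initSeg h w.1)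
    hm.aemeasurable h2
  have e2 : (γ : Measure (Path N × Path N)).map (fun w => initSeg h w.1) =
      ((γ : Measure (Path N × Path N)).map Prod.fst).map (initSeg h) := by
    rw [Measure.map_map hI measurable_fst]
    rfl
  rw [e2] at h3
  filter_upwards [h1, ae_of_ae_map hI.aemeasurable h3] with x hx hx'
  rw [hx, hx', Kernel.comap_apply]

theorem isCausal_iff {N : ℕ} {γ : ProbabilityMeasure (Path N × Path N)} :
    IsCausal γ ↔ HasCausalKernels (γ : Measure (Path N × Path N)) :=
  ⟨hasCausalKernels_of_isCausal, isCausal_of_hasCausalKernels⟩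

/-! ### Exchange of the two paths -/

theorem coe_swapPlan {N : ℕ} (γ : ProbabilityMeasure (Path N × Path N)) :
    (swapPlan γ : Measure (Path N × Path N)) =
      (γ : Measure (Path N × Path N)).map Prod.swap := rfl

theorem lintegral_swapPlan {N : ℕ} (γ : ProbabilityMeasure (Path N × Path N))
    {f : Path N × Path N → ℝ≥0∞} (hf : Measurable f) :
    ∫⁻ w, f w ∂(swapPlan γ : Measure (Path N × Path N)) =
      ∫⁻ w, f w.swap ∂(γ : Measure (Path N × Path N)) := by
  rw [coe_swapPlan, lintegral_map hf measurable_swap]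

theorem swapPlan_swapPlan {N : ℕ} (γ : ProbabilityMeasure (Path N × Path N)) :
    swapPlan (swapPlan γ) = γ := by
  apply Subtype.ext
  change Measure.map Prod.swap (Measure.map Prod.swap (γ : Measure (Path N × Path N))) = _
  rw [Measure.map_map measurable_swap measurable_swap, Prod.swap_swap_eq, Measure.map_id]
  rfl

theorem swapPlan_mem_bicausalCouplings {N : ℕ} {μ ν : ProbabilityMeasure (Path N)}
    {γ : ProbabilityMeasure (Path N × Path N)} (h : γ ∈ bicausalCouplings μ ν) :
    swapPlan γ ∈ bicausalCouplings ν μ := by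
  obtain ⟨⟨h1, h2⟩, h3, h4⟩ := h
  refine ⟨⟨?_, ?_⟩, h4, by rwa [swapPlan_swapPlan]⟩
  · rw [coe_swapPlan, Measure.map_map measurable_fst measurable_swap]
    exact h2
  · rw [coe_swapPlan, Measure.map_map measurable_snd measurable_swap]
    exact h1

theorem gap_swap (p : ℝ) {N : ℕ} (t : Fin N) (w : Path N × Path N) :
    gap p t w.swap = gap p t w := by
  simp only [gap, Prod.fst_swap, Prod.snd_swap, abs_sub_comm]

theorem CondBound.swapPlan {p : ℝ} {N : ℕ} {C : ℝ≥0∞} {γ : ProbabilityMeasure (Path N × Path N)}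
    (h : CondBound p C (γ : Measure (Path N × Path N))) :
    CondBound p C (swapPlan γ : Measure (Path N × Path N)) := by
  refine condBound_iff.2 fun t ht B hB => ?_
  have hm := measurable_initPair ht.le hB
  rw [lintegral_swapPlan γ ((measurable_gap p _).indicator hm), coe_swapPlan,
    Measure.map_apply measurable_swap hm]
  refine le_trans (le_of_eq (lintegral_congr fun w => ?_))
    (condBound_iff.1 h t ht (Prod.swap ⁻¹' B) (measurable_swap hB))
  simp only [Set.indicator, Set.mem_preimage, gap_swap]
  rfl

theorem adaptedCost_swapPlan_le {p : ℝ} (hp : 0 < p) {N : ℕ}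
    (γ : ProbabilityMeasure (Path N × Path N)) :
    adaptedCost p N (swapPlan γ) ≤ adaptedCost p N γ := by
  rcases eq_or_ne (adaptedCost p N γ) ∞ with h | h
  · exact h ▸ le_top
  · exact adaptedCost_le_of_condBound hp h _ (condBound_of_adaptedCost_le hp h _ le_rfl).swapPlan

theorem AWinf_comm_le {p : ℝ} (hp : 0 < p) {N : ℕ} (μ ν : PpSpace p N) :
    AWinf p μ ν ≤ AWinf p ν μ :=
  le_iInf₂ fun γ hγ => (iInf₂_le _ (swapPlan_mem_bicausalCouplings hγ)).trans
    (adaptedCost_swapPlan_le hp γ)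

theorem AWinf_comm {p : ℝ} (hp : 0 < p) {N : ℕ} (μ ν : PpSpace p N) :
    AWinf p μ ν = AWinf p ν μ :=
  le_antisymm (AWinf_comm_le hp μ ν) (AWinf_comm_le hp ν μ)

/-! ### The diagonal coupling -/

/-- The law of `(X, X)` for `X` with law `μ`. -/
def diagPlan {N : ℕ} (μ : ProbabilityMeasure (Path N)) : ProbabilityMeasure (Path N × Path N) :=
  μ.map (f := fun x => (x, x)) (measurable_id.prodMk measurable_id).aemeasurable

theorem coe_diagPlan {N : ℕ} (μ : ProbabilityMeasure (Path N)) :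
    (diagPlan μ : Measure (Path N × Path N)) = (μ : Measure (Path N)).map fun x => (x, x) := rfl

theorem swapPlan_diagPlan {N : ℕ} (μ : ProbabilityMeasure (Path N)) :
    swapPlan (diagPlan μ) = diagPlan μ := by
  apply Subtype.ext
  change Measure.map Prod.swap ((μ : Measure (Path N)).map fun x => (x, x)) =
    (μ : Measure (Path N)).map fun x => (x, x)
  rw [Measure.map_map measurable_swap (by fun_prop)]
  rfl

theorem isCausal_diagPlan {N : ℕ} (μ : ProbabilityMeasure (Path N)) : IsCausal (diagPlan μ) := by
  refine isCausal_iff.2 fun t h => ⟨Kernel.id, inferInstance, ?_⟩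
  have hI := measurable_initSeg h
  rw [coe_diagPlan, Measure.map_map (by fun_prop) (by fun_prop),
    Measure.map_map (by fun_prop) (by fun_prop)]
  refine Measure.ext_of_lintegral _ fun f hf => ?_
  have : ((Prod.fst : Path N × Path N → Path N) ∘ fun x => (x, x)) = id := rfl
  rw [this, Measure.map_id, lintegral_map hf (by fun_prop), Measure.lintegral_compProd hf]
  refine lintegral_congr fun x => ?_
  rw [Kernel.lintegral_comap, Kernel.lintegral_id]
  rfl

theorem diagPlan_mem_bicausalCouplings {N : ℕ} (μ : ProbabilityMeasure (Path N)) :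
    diagPlan μ ∈ bicausalCouplings μ μ := by
  refine ⟨⟨?_, ?_⟩, isCausal_diagPlan μ, by rw [swapPlan_diagPlan]; exact isCausal_diagPlan μ⟩
  · rw [coe_diagPlan, Measure.map_map measurable_fst (by fun_prop)]
    exact Measure.map_id
  · rw [coe_diagPlan, Measure.map_map measurable_snd (by fun_prop)]
    exact Measure.map_id

theorem AWinf_self {p : ℝ} (hp : 0 < p) {N : ℕ} (μ : PpSpace p N) : AWinf p μ μ = 0 := by
  refine le_antisymm (iInf₂_le_of_le _ (diagPlan_mem_bicausalCouplings μ.1) ?_) zero_le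
  refine adaptedCost_le_of_condBound hp ENNReal.zero_ne_top _ (condBound_iff.2 fun t ht B hB => ?_)
  rw [coe_diagPlan, lintegral_map ((measurable_gap p _).indicator (measurable_initPair _ hB))
    (by fun_prop)]
  refine le_of_eq_of_le ?_ zero_le
  refine lintegral_eq_zero_of_ae_eq_zero (Filter.Eventually.of_forall fun x => ?_)
  simp [gap, Set.indicator, Real.zero_rpow hp.ne']

/-! ### Comparison with the adapted Wasserstein distance -/

theorem ofReal_pNorm_rpow {p : ℝ} (hp : 0 < p) {N : ℕ} (w : Path N × Path N) :
    ENNReal.ofReal (pNorm p (w.1 - w.2) ^ p) = ∑ t, gap p t w := by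
  have hnn : ∀ t ∈ Finset.univ, 0 ≤ |(w.1 - w.2) t| ^ p := fun t _ =>
    Real.rpow_nonneg (abs_nonneg _) _
  rw [pNorm, ← Real.rpow_mul (Finset.sum_nonneg hnn), one_div_mul_cancel hp.ne', Real.rpow_one,
    ENNReal.ofReal_sum_of_nonneg hnn]
  rfl

theorem CondBound.lintegral_gap_le {p : ℝ} {N : ℕ} {C : ℝ≥0∞}
    {γ : ProbabilityMeasure (Path N × Path N)} (h : CondBound p C (γ : Measure (Path N × Path N)))
    (t : Fin N) : ∫⁻ w, gap p t w ∂(γ : Measure (Path N × Path N)) ≤ C ^ p := by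
  simpa using condBound_iff.1 h t t.2 Set.univ MeasurableSet.univ

theorem lintegral_pNorm_le {p : ℝ} (hp : 0 < p) {N : ℕ}
    (γ : ProbabilityMeasure (Path N × Path N)) (h : adaptedCost p N γ ≠ ∞) :
    ∫⁻ w, ENNReal.ofReal (pNorm p (w.1 - w.2) ^ p) ∂(γ : Measure (Path N × Path N)) ≤
      N * adaptedCost p N γ ^ p := by
  simp only [ofReal_pNorm_rpow hp]
  rw [lintegral_finsetSum _ fun t _ => measurable_gap p t]
  refine (Finset.sum_le_sum fun t _ =>
    (condBound_of_adaptedCost_le hp h γ le_rfl).lintegral_gap_le t).trans ?_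
  simp

theorem AW_le {p : ℝ} (hp : 0 < p) {N : ℕ} (μ ν : PpSpace p N) :
    AW p μ ν ≤ (N : ℝ≥0∞) ^ (1 / p) * AWinf p μ ν := by
  have hN : (N : ℝ≥0∞) ^ (1 / p) ≠ ∞ :=
    ENNReal.rpow_ne_top_of_nonneg (one_div_nonneg.2 hp.le) (ENNReal.natCast_ne_top N)
  -- For `N = 0` the constant vanishes and cannot be moved inside the infimum; there all measures
  -- agree and the diagonal plan costs nothing.
  rcases Nat.eq_zero_or_pos N with rfl | hNpos
  · refine le_of_eq_of_le ?_ zero_le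
    have : (⨅ γ ∈ bicausalCouplings μ.1 ν.1, ∫⁻ w, ENNReal.ofReal (pNorm p (w.1 - w.2) ^ p)
        ∂(γ : Measure (Path 0 × Path 0))) = 0 := by
      have hμν : μ.1 = ν.1 := by
        apply Subtype.ext
        refine Measure.ext fun s _ => ?_
        rcases Set.eq_empty_or_nonempty s with rfl | hne
        · simp
        · simp [Subsingleton.eq_univ_of_nonempty hne]
      refine le_antisymm (iInf₂_le_of_le (diagPlan μ.1) ?_ ?_) zero_le
      · rw [← hμν]
        exact diagPlan_mem_bicausalCouplings μ.1
      · simp only [ofReal_pNorm_rpow hp]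
        simp
    rw [AW, this, ENNReal.zero_rpow_of_pos (one_div_pos.2 hp)]
  have hN0 : (N : ℝ≥0∞) ^ (1 / p) ≠ 0 := by
    simp [ENNReal.rpow_eq_zero_iff, hNpos.ne', hp]
  rw [AWinf]
  simp only [ENNReal.mul_iInf_of_ne hN0 hN]
  refine le_iInf₂ fun γ hγ => ?_
  rcases eq_or_ne (adaptedCost p N γ) ∞ with h | h
  · rw [h, ENNReal.mul_top hN0]
    exact le_top
  rw [AW, one_div, ENNReal.rpow_inv_le_iff hp, ENNReal.mul_rpow_of_nonneg _ _ hp.le,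
    ← ENNReal.rpow_mul, inv_mul_cancel₀ hp.ne', ENNReal.rpow_one]
  exact iInf₂_le_of_le γ hγ (lintegral_pNorm_le hp γ h)

/-! ### Separation -/

/-- Markov's inequality: `dist` is the sup distance, so exceeding `r` makes a single coordinate
contribute at least `r ^ p`. -/
theorem measure_lt_dist_le {p r : ℝ} (hp : 0 < p) (hr : 0 < r) {N : ℕ}
    (γ : Measure (Path N × Path N)) :
    γ {w | r < dist w.1 w.2} ≤
      (∫⁻ w, ENNReal.ofReal (pNorm p (w.1 - w.2) ^ p) ∂γ) / ENNReal.ofReal (r ^ p) := by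
  have hrp : 0 < r ^ p := Real.rpow_pos_of_pos hr p
  have hm : Measurable fun w : Path N × Path N => ENNReal.ofReal (pNorm p (w.1 - w.2) ^ p) := by
    simp only [ofReal_pNorm_rpow hp]
    exact Finset.measurable_sum _ fun t _ => measurable_gap p t
  refine (measure_mono fun w hw => ?_).trans (meas_ge_le_lintegral_div hm.aemeasurable
    (ENNReal.ofReal_pos.2 hrp).ne' ENNReal.ofReal_ne_top)
  obtain ⟨t, ht⟩ : ∃ t, r < dist (w.1 t) (w.2 t) := by
    by_contra! hcon
    exact (not_le.2 hw) ((dist_pi_le_iff hr.le).2 hcon)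
  change ENNReal.ofReal (r ^ p) ≤ ENNReal.ofReal (pNorm p (w.1 - w.2) ^ p)
  rw [ofReal_pNorm_rpow hp]
  refine le_trans (ENNReal.ofReal_le_ofReal (Real.rpow_le_rpow hr.le ht.le hp.le)) ?_
  exact Finset.single_le_sum (f := fun t => gap p t w) (fun _ _ => zero_le) (Finset.mem_univ t)

theorem measure_le_cthickening_of_AW_eq_zero {p : ℝ} (hp : 0 < p) {N : ℕ} {μ ν : PpSpace p N}
    (h : AW p μ ν = 0) {r : ℝ} (hr : 0 < r) {A : Set (Path N)} (hA : MeasurableSet A) :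
    (μ.1 : Measure (Path N)) A ≤ (ν.1 : Measure (Path N)) (Metric.cthickening r A) := by
  rw [AW, ENNReal.rpow_eq_zero_iff_of_pos (one_div_pos.2 hp)] at h
  have hrp : 0 < ENNReal.ofReal (r ^ p) := ENNReal.ofReal_pos.2 (Real.rpow_pos_of_pos hr p)
  refine ENNReal.le_of_forall_pos_le_add fun ε hε _ => ?_
  -- The threshold `ε * r ^ p` is chosen so that Markov's inequality leaves mass at most `ε` at
  -- distance more than `r`.
  have hlt : (⨅ γ ∈ bicausalCouplings μ.1 ν.1, ∫⁻ w, ENNReal.ofReal (pNorm p (w.1 - w.2) ^ p)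
      ∂(γ : Measure (Path N × Path N))) < ε * ENNReal.ofReal (r ^ p) := by
    rw [h]
    exact ENNReal.mul_pos (ENNReal.coe_pos.2 hε).ne' hrp.ne'
  simp only [iInf_lt_iff] at hlt
  obtain ⟨γ, hγ, hlt⟩ := hlt
  rw [← hγ.1.1, ← hγ.1.2, Measure.map_apply measurable_fst hA,
    Measure.map_apply measurable_snd Metric.isClosed_cthickening.measurableSet]
  have hsub : (Prod.fst ⁻¹' A : Set (Path N × Path N)) ⊆
      Prod.snd ⁻¹' (Metric.cthickening r A) ∪ {w | r < dist w.1 w.2} := by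
    intro w hw
    rcases le_or_gt (dist w.1 w.2) r with hd | hd
    · exact Or.inl (Metric.mem_cthickening_of_dist_le _ w.1 r A hw (by rwa [dist_comm]))
    · exact Or.inr hd
  refine (measure_mono hsub).trans ((measure_union_le _ _).trans (add_le_add le_rfl ?_))
  refine (measure_lt_dist_le hp hr _).trans (ENNReal.div_le_of_le_mul hlt.le)

theorem measure_closed_le_of_AW_eq_zero {p : ℝ} (hp : 0 < p) {N : ℕ} {μ ν : PpSpace p N}
    (h : AW p μ ν = 0) {A : Set (Path N)} (hA : IsClosed A) :
    (μ.1 : Measure (Path N)) A ≤ (ν.1 : Measure (Path N)) A := by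
  have hlim := tendsto_measure_cthickening_of_isClosed (μ := (ν.1 : Measure (Path N)))
    ⟨1, one_pos, measure_ne_top _ _⟩ hA
  refine ge_of_tendsto (hlim.mono_left (nhdsWithin_le_nhds (s := Set.Ioi 0))) ?_
  filter_upwards [self_mem_nhdsWithin] with r hr
  exact measure_le_cthickening_of_AW_eq_zero hp h hr hA.measurableSet

theorem eq_of_AWinf_eq_zero {p : ℝ} (hp : 0 < p) {N : ℕ} {μ ν : PpSpace p N}
    (h : AWinf p μ ν = 0) : μ = ν := by
  have h1 : AW p μ ν = 0 := le_antisymm ((AW_le hp μ ν).trans (by rw [h, mul_zero])) zero_le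
  have h2 : AW p ν μ = 0 :=
    le_antisymm ((AW_le hp ν μ).trans (by rw [AWinf_comm hp, h, mul_zero])) zero_le
  refine Subtype.ext (Subtype.ext ?_)
  change (μ.1 : Measure (Path N)) = (ν.1 : Measure (Path N))
  refine ext_of_generate_finite _ (BorelSpace.measurable_eq.trans
    borel_eq_generateFrom_isClosed) isPiSystem_isClosed (fun A hA => ?_) (by simp)
  exact le_antisymm (measure_closed_le_of_AW_eq_zero hp h1 hA)
    (measure_closed_le_of_AW_eq_zero hp h2 hA)

/-! ### Gluing of plans -/

/-- The law of `(Y, (X, Z))` for which `(Y, X)` has law `ρ`, `Z` has the same conditional law given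
`Y` as under `ρ'`, and `X`, `Z` are conditionally independent given `Y`. -/
def gluing {N : ℕ} (ρ ρ' : ProbabilityMeasure (Path N × Path N)) :
    Measure (Path N × (Path N × Path N)) :=
  (ρ : Measure (Path N × Path N)).fst ⊗ₘ
    ((ρ : Measure (Path N × Path N)).condKernel ×ₖ (ρ' : Measure (Path N × Path N)).condKernel)

instance {N : ℕ} (ρ ρ' : ProbabilityMeasure (Path N × Path N)) :
    IsProbabilityMeasure (gluing ρ ρ') := by
  unfold gluing
  infer_instance

/-- The law of `(X, Z)` under `gluing`. -/
def gluedPlan {N : ℕ} (ρ ρ' : ProbabilityMeasure (Path N × Path N)) :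
    ProbabilityMeasure (Path N × Path N) :=
  ⟨(gluing ρ ρ').map Prod.snd, Measure.isProbabilityMeasure_map measurable_snd.aemeasurable⟩

theorem coe_gluedPlan {N : ℕ} (ρ ρ' : ProbabilityMeasure (Path N × Path N)) :
    (gluedPlan ρ ρ' : Measure (Path N × Path N)) = (gluing ρ ρ').map Prod.snd := rfl

variable {N : ℕ} {ρ ρ' : ProbabilityMeasure (Path N × Path N)}

theorem lintegral_gluing {f : Path N × (Path N × Path N) → ℝ≥0∞} (hf : Measurable f) :
    ∫⁻ v, f v ∂(gluing ρ ρ') =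
      ∫⁻ y, ∫⁻ x, ∫⁻ z, f (y, (x, z)) ∂((ρ' : Measure (Path N × Path N)).condKernel y)
        ∂((ρ : Measure (Path N × Path N)).condKernel y) ∂(ρ : Measure (Path N × Path N)).fst := by
  rw [gluing, Measure.lintegral_compProd hf]
  exact lintegral_congr fun y => Kernel.lintegral_prod _ _ _ (hf.comp measurable_prodMk_left)

theorem lintegral_gluing_left {f : Path N × Path N → ℝ≥0∞} (hf : Measurable f) :
    ∫⁻ v, f (v.1, v.2.1) ∂(gluing ρ ρ') = ∫⁻ w, f w ∂(ρ : Measure (Path N × Path N)) := by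
  rw [lintegral_gluing (f := fun v => f (v.1, v.2.1)) (by fun_prop),
    ← Measure.lintegral_condKernel hf]
  simp

/-- By Tonelli, the conditionally independent `X` and `Z` play symmetric roles. Facts about one of
them therefore transfer to the other. -/
theorem gluing_swap
    (h : (ρ : Measure (Path N × Path N)).fst = (ρ' : Measure (Path N × Path N)).fst) :
    gluing ρ' ρ = (gluing ρ ρ').map fun v => (v.1, v.2.swap) := by
  refine Measure.ext_of_lintegral _ fun f hf => ?_
  have hs : Measurable fun v : Path N × (Path N × Path N) => (v.1, v.2.swap) := by fun_prop
  rw [lintegral_map hf hs, lintegral_gluing (f := fun v => f (v.1, v.2.swap)) (hf.comp hs),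
    lintegral_gluing hf, h]
  refine lintegral_congr fun y => ?_
  refine lintegral_lintegral_swap (Measurable.aemeasurable ?_)
  exact hf.comp (measurable_const.prodMk measurable_id)

theorem gluedPlan_swap
    (h : (ρ : Measure (Path N × Path N)).fst = (ρ' : Measure (Path N × Path N)).fst) :
    swapPlan (gluedPlan ρ ρ') = gluedPlan ρ' ρ := by
  apply Subtype.ext
  change ((gluing ρ ρ').map Prod.snd).map Prod.swap = (gluing ρ' ρ).map Prod.snd
  rw [gluing_swap h, Measure.map_map measurable_swap measurable_snd,
    Measure.map_map measurable_snd (by fun_prop)]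
  rfl

theorem gluedPlan_map_fst : (gluedPlan ρ ρ' : Measure (Path N × Path N)).map Prod.fst =
    (ρ : Measure (Path N × Path N)).map Prod.snd := by
  refine Measure.ext_of_lintegral _ fun f hf => ?_
  rw [coe_gluedPlan, Measure.map_map measurable_fst measurable_snd,
    lintegral_map hf (by fun_prop), lintegral_map hf measurable_snd,
    ← lintegral_gluing_left (ρ' := ρ') (f := fun w => f w.2) (by fun_prop)]
  rfl

/-- Under causality of `ρ'`, the segment `Z_{1:t}` is conditionally independent of `(X, Y)`
given `Y_{1:t}`. -/
theorem exists_lintegral_gluing_initSeg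
    (h : (ρ : Measure (Path N × Path N)).fst = (ρ' : Measure (Path N × Path N)).fst)
    (hρ' : HasCausalKernels (ρ' : Measure (Path N × Path N))) {t : ℕ} (ht : t ≤ N) :
    ∃ k : Kernel (Path t) (Path t), IsMarkovKernel k ∧
      ∀ f : Path N × (Path N × Path t) → ℝ≥0∞, Measurable f →
        ∫⁻ v, f (v.1, (v.2.1, initSeg ht v.2.2)) ∂(gluing ρ ρ') =
          ∫⁻ w, ∫⁻ a, f (w.1, (w.2, a)) ∂(k (initSeg ht w.1))
            ∂(ρ : Measure (Path N × Path N)) := by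
  obtain ⟨k, hk, heq⟩ := hρ' t ht
  refine ⟨k, hk, fun f hf => ?_⟩
  have hI := measurable_initSeg ht
  -- Disintegrations are almost everywhere unique, so the conditional law of `Z_{1:t}` given `Y` is
  -- `k` at `Y_{1:t}`.
  have hker : ((ρ' : Measure (Path N × Path N)).condKernel.map (initSeg ht) : _ → _) =ᵐ[
      (ρ' : Measure (Path N × Path N)).fst] (k.comap (initSeg ht) hI) := by
    have : IsMarkovKernel ((ρ' : Measure (Path N × Path N)).condKernel.map (initSeg ht)) :=
      Kernel.IsMarkovKernel.map _ hI
    refine Kernel.ae_eq_of_compProd_eq ?_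
    refine Eq.trans ?_ heq
    refine Measure.ext_of_lintegral _ fun g hg => ?_
    rw [Measure.lintegral_compProd hg, lintegral_map hg (by fun_prop),
      ← Measure.lintegral_condKernel (f := fun w => g (w.1, initSeg ht w.2)) (by fun_prop)]
    refine lintegral_congr fun y => ?_
    rw [Kernel.map_apply _ hI, lintegral_map (by fun_prop) hI]
  have hF : Measurable fun w : Path N × Path N =>
      ∫⁻ a, f (w.1, (w.2, a)) ∂(k (initSeg ht w.1)) := by
    have : Measurable fun v : (Path N × Path N) × Path t => f (v.1.1, (v.1.2, v.2)) := by fun_prop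
    exact this.lintegral_kernel_prod_right'
      (κ := k.comap (fun w : Path N × Path N => initSeg ht w.1) (hI.comp measurable_fst))
  rw [lintegral_gluing (f := fun v => f (v.1, (v.2.1, initSeg ht v.2.2))) (by fun_prop),
    ← Measure.lintegral_condKernel hF]
  refine lintegral_congr_ae ?_
  rw [h]
  filter_upwards [hker] with y hy
  refine lintegral_congr fun x => ?_
  rw [← Kernel.comap_apply k hI y, ← hy, Kernel.map_apply _ hI, lintegral_map (by fun_prop) hI]

theorem isCausal_gluedPlan
    (h : (ρ : Measure (Path N × Path N)).fst = (ρ' : Measure (Path N × Path N)).fst)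
    (hρ : IsCausal (swapPlan ρ)) (hρ' : IsCausal ρ') : IsCausal (gluedPlan ρ ρ') := by
  rw [isCausal_iff] at *
  intro t ht
  obtain ⟨k, hk, hke⟩ := hρ t ht
  obtain ⟨k', hk', hke'⟩ := exists_lintegral_gluing_initSeg h hρ' ht
  have hI := measurable_initSeg ht
  -- Given `X`, the segment `Y_{1:t}` is drawn from `X_{1:t}` by `k`, then `Z_{1:t}` from `Y_{1:t}`
  -- by `k'`.
  refine ⟨k' ∘ₖ k, inferInstance, ?_⟩
  have hfst : (gluedPlan ρ ρ' : Measure (Path N × Path N)).map Prod.fst =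
      (swapPlan ρ : Measure (Path N × Path N)).map Prod.fst := by
    rw [gluedPlan_map_fst, coe_swapPlan, Measure.map_map measurable_fst measurable_swap]
    rfl
  have : IsProbabilityMeasure ((swapPlan ρ : Measure (Path N × Path N)).map Prod.fst) :=
    Measure.isProbabilityMeasure_map measurable_fst.aemeasurable
  rw [hfst]
  refine Measure.ext_of_lintegral _ fun f hf => ?_
  have hg : Measurable fun w : Path N × Path t => ∫⁻ a, f (w.1, a) ∂(k' w.2) := by
    have : Measurable fun v : (Path N × Path t) × Path t => f (v.1.1, v.2) := by fun_prop
    exact this.lintegral_kernel_prod_right' (κ := k'.comap Prod.snd measurable_snd)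
  calc ∫⁻ w, f w ∂((gluedPlan ρ ρ' : Measure (Path N × Path N)).map
        fun w => (w.1, initSeg ht w.2))
      = ∫⁻ v, f (v.2.1, initSeg ht v.2.2) ∂(gluing ρ ρ') := by
        rw [lintegral_map hf (by fun_prop), coe_gluedPlan,
          lintegral_map (f := fun w : Path N × Path N => f (w.1, initSeg ht w.2)) (by fun_prop)
            measurable_snd]
    _ = ∫⁻ w, ∫⁻ a, f (w.2, a) ∂(k' (initSeg ht w.1)) ∂(ρ : Measure (Path N × Path N)) :=
        hke' (fun v => f v.2) (by fun_prop)
    _ = ∫⁻ w, ∫⁻ a, f (w.1, a) ∂(k' (initSeg ht w.2))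
          ∂(swapPlan ρ : Measure (Path N × Path N)) := by
        rw [lintegral_swapPlan]
        · rfl
        · exact hg.comp (measurable_fst.prodMk (hI.comp measurable_snd))
    _ = ∫⁻ w, ∫⁻ a, f (w.1, a) ∂(k' w.2) ∂((swapPlan ρ : Measure (Path N × Path N)).map
          fun w => (w.1, initSeg ht w.2)) := by
        rw [lintegral_map hg (by fun_prop)]
    _ = _ := by
        rw [hke, Measure.lintegral_compProd hg, Measure.lintegral_compProd hf]
        refine lintegral_congr fun x => ?_
        rw [Kernel.lintegral_comap, Kernel.lintegral_comap]
        exact (Kernel.lintegral_comp _ _ _ (hf.comp measurable_prodMk_left)).symm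

/-- Integrating out `Z_{1:t}` by its kernel turns `f` into a function of `(Y_{1:t}, X_{1:t})`, and
the bound for `ρ`, the law of `(Y, X)`, applies to that function. -/
theorem lintegral_gap_gluing_le {p : ℝ} {C : ℝ≥0∞}
    (h : (ρ : Measure (Path N × Path N)).fst = (ρ' : Measure (Path N × Path N)).fst)
    (hρ' : IsCausal ρ') (hC : CondBound p C (ρ : Measure (Path N × Path N))) {t : ℕ} (ht : t < N)
    {f : Path t × Path t → ℝ≥0∞} (hf : Measurable f) :
    ∫⁻ v, gap p ⟨t, ht⟩ (v.1, v.2.1) * f (initPair ht.le v.2) ∂(gluing ρ ρ') ≤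
      C ^ p * ∫⁻ v, f (initPair ht.le v.2) ∂(gluing ρ ρ') := by
  obtain ⟨k, hk, hke⟩ := exists_lintegral_gluing_initSeg h (isCausal_iff.1 hρ') ht.le
  have hI := measurable_initSeg ht.le
  have hgap := measurable_gap p (⟨t, ht⟩ : Fin N)
  have hg : Measurable fun s : Path t × Path t => ∫⁻ a, f (s.2, a) ∂(k s.1) := by
    have : Measurable fun v : (Path t × Path t) × Path t => f (v.1.2, v.2) := by fun_prop
    exact this.lintegral_kernel_prod_right' (κ := k.comap Prod.fst measurable_fst)
  have e1 := hke (fun v => gap p ⟨t, ht⟩ (v.1, v.2.1) * f (initSeg ht.le v.2.1, v.2.2))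
    (by fun_prop)
  have e2 := hke (fun v => f (initSeg ht.le v.2.1, v.2.2)) (by fun_prop)
  refine le_of_eq_of_le e1 (le_of_le_of_eq ?_ (congrArg (C ^ p * ·) e2.symm))
  refine le_of_eq_of_le (lintegral_congr fun w => ?_) (hC.lintegral_le ht hg)
  exact lintegral_const_mul (f := fun a => f ((initPair ht.le w).2, a)) (gap p ⟨t, ht⟩ w)
    (hf.comp measurable_prodMk_left)

theorem condBound_gluedPlan {p : ℝ} (hp : 1 ≤ p) {C C' : ℝ≥0∞}
    (h : (ρ : Measure (Path N × Path N)).fst = (ρ' : Measure (Path N × Path N)).fst)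
    (hρ : IsCausal ρ) (hρ' : IsCausal ρ') (hC : CondBound p C (ρ : Measure (Path N × Path N)))
    (hC' : CondBound p C' (ρ' : Measure (Path N × Path N))) :
    CondBound p (C + C') (gluedPlan ρ ρ' : Measure (Path N × Path N)) := by
  have hp0 : 0 < p := zero_lt_one.trans_le hp
  refine condBound_iff.2 fun t ht B hB => ?_
  have hmB := measurable_initPair ht.le hB
  have hs : Measurable fun v : Path N × (Path N × Path N) => (v.1, v.2.swap) := by fun_prop
  have h1B : Measurable (B.indicator (1 : Path t × Path t → ℝ≥0∞)) := measurable_one.indicator hB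
  have hgap := measurable_gap p (⟨t, ht⟩ : Fin N)
  -- `D` is the event that `(X_{1:t}, Z_{1:t})` lies in `B`; Minkowski is applied on `D`.
  set D : Set (Path N × (Path N × Path N)) := Prod.snd ⁻¹' (initPair ht.le ⁻¹' B) with hD
  have hmD : MeasurableSet D := measurable_snd hmB
  have hind : ∀ g : Path N × (Path N × Path N) → ℝ≥0∞,
      ∫⁻ v in D, g v ∂(gluing ρ ρ') =
        ∫⁻ v, g v * B.indicator 1 (initPair ht.le v.2) ∂(gluing ρ ρ') := by
    intro g
    rw [← lintegral_indicator hmD]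
    refine lintegral_congr fun v => ?_
    by_cases hv : initPair ht.le v.2 ∈ B
    · rw [Set.indicator_of_mem (show v ∈ D from hv), Set.indicator_of_mem hv, Pi.one_apply, mul_one]
    · rw [Set.indicator_of_notMem (show v ∉ D from hv), Set.indicator_of_notMem hv, mul_zero]
  have hDB : ∫⁻ v, B.indicator 1 (initPair ht.le v.2) ∂(gluing ρ ρ') = gluing ρ ρ' D := by
    rw [← lintegral_indicator_one hmD]
    rfl
  have hxy : ∫⁻ v in D, gap p ⟨t, ht⟩ (v.1, v.2.1) ∂(gluing ρ ρ') ≤ C ^ p * gluing ρ ρ' D := by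
    rw [hind, ← hDB]
    exact lintegral_gap_gluing_le h hρ' hC ht h1B
  have hyz : ∫⁻ v in D, gap p ⟨t, ht⟩ (v.1, v.2.2) ∂(gluing ρ ρ') ≤ C' ^ p * gluing ρ ρ' D := by
    rw [hind, ← hDB]
    have key := lintegral_gap_gluing_le h.symm hρ hC' ht (h1B.comp measurable_swap)
    have hmf : Measurable fun v : Path N × (Path N × Path N) =>
        (B.indicator 1 ∘ Prod.swap) (initPair ht.le v.2) :=
      (h1B.comp measurable_swap).comp ((measurable_initPair ht.le).comp measurable_snd)
    rw [gluing_swap h, lintegral_map hmf hs, lintegral_map (by fun_prop) hs] at key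
    exact key
  rw [coe_gluedPlan, Measure.map_apply measurable_snd hmB,
    lintegral_map (hgap.indicator hmB) measurable_snd]
  change ∫⁻ v, D.indicator (fun v => gap p ⟨t, ht⟩ v.2) v ∂(gluing ρ ρ') ≤ _ * gluing ρ ρ' D
  rw [lintegral_indicator hmD]
  let a : Path N × (Path N × Path N) → ℝ≥0∞ := fun v => ENNReal.ofReal |v.1 ⟨t, ht⟩ - v.2.1 ⟨t, ht⟩|
  let b : Path N × (Path N × Path N) → ℝ≥0∞ := fun v => ENNReal.ofReal |v.1 ⟨t, ht⟩ - v.2.2 ⟨t, ht⟩|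
  have ha : ∀ v, a v ^ p = gap p ⟨t, ht⟩ (v.1, v.2.1) := fun v =>
    ENNReal.ofReal_rpow_of_nonneg (abs_nonneg _) hp0.le
  have hb : ∀ v, b v ^ p = gap p ⟨t, ht⟩ (v.1, v.2.2) := fun v =>
    ENNReal.ofReal_rpow_of_nonneg (abs_nonneg _) hp0.le
  have hab : ∀ v, gap p ⟨t, ht⟩ v.2 ≤ (a + b) v ^ p := by
    intro v
    rw [gap, ← ENNReal.ofReal_rpow_of_nonneg (abs_nonneg _) hp0.le]
    refine ENNReal.rpow_le_rpow ?_ hp0.le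
    rw [Pi.add_apply, ← ENNReal.ofReal_add (abs_nonneg _) (abs_nonneg _)]
    refine ENNReal.ofReal_le_ofReal ?_
    rw [abs_sub_comm (v.1 ⟨t, ht⟩) (v.2.1 ⟨t, ht⟩)]
    exact abs_sub_le _ _ _
  have hma : Measurable a := by fun_prop
  have hmb : Measurable b := by fun_prop
  have hmink := ENNReal.lintegral_Lp_add_le (μ := (gluing ρ ρ').restrict D) hma.aemeasurable
    hmb.aemeasurable hp
  simp only [ha, hb] at hmink
  -- After taking `p`-th roots both bounds carry the common factor `m ^ (1 / p)`, where `m` is the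
  -- mass of `D`, so the constants add.
  have hroot : ∀ c m : ℝ≥0∞, (c ^ p * m) ^ (1 / p) = c * m ^ (1 / p) := fun c m => by
    rw [ENNReal.mul_rpow_of_nonneg _ _ (one_div_nonneg.2 hp0.le), ← ENNReal.rpow_mul,
      mul_one_div_cancel hp0.ne', ENNReal.rpow_one]
  have hfin : (∫⁻ v in D, (a + b) v ^ p ∂(gluing ρ ρ')) ^ (1 / p) ≤
      ((C + C') ^ p * gluing ρ ρ' D) ^ (1 / p) := by
    refine hmink.trans ?_
    rw [hroot, add_mul, ← hroot C, ← hroot C']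
    exact add_le_add (ENNReal.rpow_le_rpow hxy (one_div_nonneg.2 hp0.le))
      (ENNReal.rpow_le_rpow hyz (one_div_nonneg.2 hp0.le))
  exact (lintegral_mono hab).trans ((ENNReal.rpow_le_rpow_iff (one_div_pos.2 hp0)).1 hfin)

theorem AWinf_triangle {p : ℝ} (hp : 1 ≤ p) {N : ℕ} (μ ν η : PpSpace p N) :
    AWinf p μ ν ≤ AWinf p μ η + AWinf p η ν := by
  have hp0 : 0 < p := zero_lt_one.trans_le hp
  refine ENNReal.le_iInf₂_add_iInf₂ fun γ hγ γ' hγ' => ?_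
  rcases eq_or_ne (adaptedCost p N γ) ∞ with hγt | hγt
  · simp [hγt]
  rcases eq_or_ne (adaptedCost p N γ') ∞ with hγt' | hγt'
  · simp [hγt']
  -- Gluing requires the shared marginal `η` in first position, so `γ` is reversed.
  have hσ := swapPlan_mem_bicausalCouplings hγ
  have h : (swapPlan γ : Measure (Path N × Path N)).fst = (γ' : Measure (Path N × Path N)).fst :=
    hσ.1.1.trans hγ'.1.1.symm
  have hmem : gluedPlan (swapPlan γ) γ' ∈ bicausalCouplings μ.1 ν.1 := by
    refine ⟨⟨gluedPlan_map_fst.trans hσ.1.2, ?_⟩, isCausal_gluedPlan h hσ.2.2 hγ'.2.1, ?_⟩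
    · rw [← swapPlan_swapPlan (gluedPlan (swapPlan γ) γ'), gluedPlan_swap h, coe_swapPlan,
        Measure.map_map measurable_snd measurable_swap]
      exact gluedPlan_map_fst.trans hγ'.1.2
    · rw [gluedPlan_swap h]
      exact isCausal_gluedPlan h.symm hγ'.2.2 hσ.2.1
  refine iInf₂_le_of_le _ hmem (adaptedCost_le_of_condBound hp0 (ENNReal.add_ne_top.2 ⟨hγt, hγt'⟩) _
    (condBound_gluedPlan hp h hσ.2.1 hγ'.2.1 ?_ ?_))
  · exact (condBound_of_adaptedCost_le hp0 hγt γ le_rfl).swapPlan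
  · exact condBound_of_adaptedCost_le hp0 hγt' γ' le_rfl

end AdaptedWasserstein

end

theorem mainTheorem7 (p : ℝ) (hp : 1 ≤ p) (N : ℕ) :
    (∀ μ ν : AdaptedWasserstein.PpSpace p N,
      AdaptedWasserstein.AWinf p μ ν = 0 ↔ μ = ν) ∧
    (∀ μ ν : AdaptedWasserstein.PpSpace p N,
      AdaptedWasserstein.AWinf p μ ν = AdaptedWasserstein.AWinf p ν μ) ∧
    (∀ μ ν η : AdaptedWasserstein.PpSpace p N,
      AdaptedWasserstein.AWinf p μ ν ≤
        AdaptedWasserstein.AWinf p μ η + AdaptedWasserstein.AWinf p η ν) ∧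
    (∀ μ ν : AdaptedWasserstein.PpSpace p N,
      AdaptedWasserstein.AW p μ ν ≤
        (N : ENNReal) ^ (1 / p) * AdaptedWasserstein.AWinf p μ ν) := by
  have hp0 : 0 < p := zero_lt_one.trans_le hp
  refine ⟨fun μ ν => ⟨AdaptedWasserstein.eq_of_AWinf_eq_zero hp0, ?_⟩,
    AdaptedWasserstein.AWinf_comm hp0, AdaptedWasserstein.AWinf_triangle hp,
    AdaptedWasserstein.AW_le hp0⟩
  rintro rfl
  exact AdaptedWasserstein.AWinf_self hp0 μ
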